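/- Let $p\in[2,\infty)$ and let $X$ be a real Banach space whose norm is $p$-uniformly convex, i.e. for some constant $K\ge 1$ and all $x,y\in X$, $$\|x\|^p+\frac1{K^p}\|y\|^p\le\frac{\|x+y\|^p+\|x-y\|^p}{2}.$$ Let $\omega$ be a non-zero, bounded, antisymmetric bilinear form $X\times X\to\mathbb R$. Let $\mathbb H(\omega)$ be the Heisenberg group over $\omega$, i.e. the set $X\times\mathbb R$ with the product $(x,s)*(y,t)=(x+y,\,s+t+\omega(x,y))$. A pair of Lipschitz curves $\gamma:[0,1]\to X$, $z:[0,1]\to\mathbb R$ is called horizontal if, for almost every $t\in[0,1]$, $\gamma$ and $z$ are differentiable at $t$ and $z'(t)=\omega(\gamma(t),\gamma'(t))$. Let $d_{cc}(\mathbf a,\mathbf b)$ be the infimum of the lengths of $\gamma$ over all horizontal curves $(\gamma,z)$ from $\mathbf a$ to $\mathbf b$. Then $d_{cc}$ is a (finite) metric on $\mathbb H(\omega)$, and the metric space $(\mathbb H(\omega),d_{cc})$ is Markov $2p$-convex. Here, for $q>0$, a metric space $(M,d)$ is called Markov $q$-convex if there is a constant $\Pi>0$ such that for every Markov chain $\{W_t\}_{t\in\mathbb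 Z}$ (not necessarily time-homogeneous) with values in a measurable space $\Omega$ and transition kernels $(\kappa_t)_{t\in\mathbb Z}$, and for every strongly measurable $f:\Omega\to M$ (every map $f:\Omega\to M$, if $\Omega$ is countable and its points are measurable), $$\sum_{s=0}^\infty\sum_{t\in\mathbb Z}\frac{\mathbb E\big[d\big(f(W_t),f(\widetilde W_t(t-2^s))\big)^q\big]}{2^{sq}}\le\Pi^q\sum_{t\in\mathbb Z}\mathbb E\big[d\big(f(W_t),f(W_{t-1})\big)^q\big],$$ where both sides are sums in $[0,\infty]$ and, for $\tau\in\mathbb Z$, $\{\widetilde W_t(\tau)\}_{t\in\mathbb Z}$ is the process which equals $W_t$ for $t\le\tau$ and evolves independently, with the same transition kernels, for $t>\tau$. -/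

import Mathlib

open MeasureTheory ProbabilityTheory Set
open scoped ENNReal NNReal

universe u v

/-- The norm of `X` is `p`-uniformly convex: for some `K ≥ 1` and all `x, y`,
`‖x‖ ^ p + K ^ (-p) * ‖y‖ ^ p ≤ (‖x + y‖ ^ p + ‖x - y‖ ^ p) / 2`. -/
def IsPUniformlyConvex (p : ℝ) (X : Type u) [NormedAddCommGroup X] : Prop :=
  ∃ K : ℝ, 1 ≤ K ∧ ∀ x y : X,
    ‖x‖ ^ p + 1 / K ^ p * ‖y‖ ^ p ≤ (‖x + y‖ ^ p + ‖x - y‖ ^ p) / 2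

/-! ### The Heisenberg group of a bilinear form and its Carnot-Caratheodory distance -/

/-- The underlying set `X × ℝ` of the Heisenberg group of the bounded bilinear form `ω`. -/
@[ext]
structure HeisenbergGroup {X : Type u} [NormedAddCommGroup X] [NormedSpace ℝ X]
    (ω : X →L[ℝ] X →L[ℝ] ℝ) : Type u where
  /-- the component in `X` -/
  base : X
  /-- the central component -/
  height : ℝ

namespace HeisenbergGroup

variable {X : Type u} [NormedAddCommGroup X] [NormedSpace ℝ X] {ω : X →L[ℝ] X →L[ℝ] ℝ}

/-- The group law `(x, s) * (y, t) = (x + y, s + t + ω x y)`, with identity `(0, 0)`.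
The inverse of `(x, s)` is `(-x, ω x x - s)`, which is `(-x, -s)` when `ω` is antisymmetric. -/
noncomputable instance : Group (HeisenbergGroup ω) where
  mul a b := ⟨a.base + b.base, a.height + b.height + ω a.base b.base⟩
  one := ⟨0, 0⟩
  inv a := ⟨-a.base, ω a.base a.base - a.height⟩
  mul_assoc a b c := by
    refine HeisenbergGroup.ext (add_assoc _ _ _) ?_
    change a.height + b.height + ω a.base b.base + c.height + ω (a.base + b.base) c.base =
      a.height + (b.height + c.height + ω b.base c.base) + ω a.base (b.base + c.base)
    simp only [map_add, add_apply]
    ring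
  one_mul a := by
    refine HeisenbergGroup.ext (zero_add _) ?_
    change 0 + a.height + ω 0 a.base = a.height
    simp
  mul_one a := by
    refine HeisenbergGroup.ext (add_zero _) ?_
    change a.height + 0 + ω a.base 0 = a.height
    simp
  inv_mul_cancel a := by
    refine HeisenbergGroup.ext (neg_add_cancel _) ?_
    change ω a.base a.base - a.height + a.height + ω (-a.base) a.base = 0
    simp

end HeisenbergGroup

/-- `(γ, z)` is a horizontal curve for `ω`: both components are Lipschitz on `[0, 1]`, and for
almost every `t ∈ [0, 1]` the curve `γ` is differentiable at `t` and `z' t = ω (γ t) (γ' t)`.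
(Values outside `[0, 1]` play no role.) -/
structure IsHorizontalCurve {X : Type u} [NormedAddCommGroup X] [NormedSpace ℝ X]
    (ω : X →L[ℝ] X →L[ℝ] ℝ) (γ : ℝ → X) (z : ℝ → ℝ) : Prop where
  lipschitz_base : ∃ C : ℝ≥0, LipschitzOnWith C γ (Icc 0 1)
  lipschitz_height : ∃ C : ℝ≥0, LipschitzOnWith C z (Icc 0 1)
  horizontal : ∀ᵐ t ∂(volume.restrict (Icc (0 : ℝ) 1)),
    ∃ γ' : X, HasDerivAt γ γ' t ∧ HasDerivAt z (ω (γ t) γ') t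

/-- The Carnot-Caratheodory distance: the infimum of the lengths (total variations) of `γ` over
all horizontal curves `(γ, z)` on `[0, 1]` from `a` to `b`; it is `∞` if there is no such curve. -/
noncomputable def ccDist {X : Type u} [NormedAddCommGroup X] [NormedSpace ℝ X]
    (ω : X →L[ℝ] X →L[ℝ] ℝ) (a b : HeisenbergGroup ω) : ℝ≥0∞ :=
  sInf {L : ℝ≥0∞ | ∃ (γ : ℝ → X) (z : ℝ → ℝ), IsHorizontalCurve ω γ z ∧
    γ 0 = a.base ∧ z 0 = a.height ∧ γ 1 = b.base ∧ z 1 = b.height ∧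
    L = eVariationOn γ (Icc 0 1)}

/-! ### Markov convexity -/

/-- `W` is a (not necessarily time-homogeneous) Markov chain, indexed by `ℤ`, with transition
probabilities `κ t` from time `t` to time `t + 1`: the conditional law of `W (t + 1)` given
`(W s)_{s ≤ t}` is `κ t (W t)`. -/
structure IsMarkovChain {Ω S : Type v} [MeasurableSpace Ω] [MeasurableSpace S]
    (κ : ℤ → Kernel Ω Ω) (P : Measure S) (W : ℤ → S → Ω) : Prop where
  measurable : ∀ t, Measurable (W t)
  map_eq : ∀ t : ℤ,
    P.map (fun ξ => ((fun s : Iic t => W s ξ), W (t + 1) ξ)) =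
      P.map (fun ξ => (fun s : Iic t => W s ξ)) ⊗ₘ
        (κ t).comap (fun h : Iic t → Ω => h ⟨t, self_mem_Iic⟩) (measurable_pi_apply (⟨t, self_mem_Iic⟩ : Iic t))

/-- `V` equals `W` up to time `τ`, and after time `τ` it evolves independently of `W` with the
transition probabilities `κ`: for `t ≥ τ`, the conditional law of `V (t + 1)` given the whole
trajectory of `W` and `(V s)_{s ≤ t}` is `κ t (V t)`. -/
structure IsResampledAfter {Ω S : Type v} [MeasurableSpace Ω] [MeasurableSpace S]
    (κ : ℤ → Kernel Ω Ω) (P : Measure S) (W : ℤ → S → Ω) (τ : ℤ) (V : ℤ → S → Ω) : Prop where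
  measurable : ∀ t, Measurable (V t)
  ae_eq_of_le : ∀ t ≤ τ, V t =ᵐ[P] W t
  map_eq : ∀ t : ℤ, τ ≤ t →
    P.map (fun ξ => (((fun s : ℤ => W s ξ), (fun s : Iic t => V s ξ)), V (t + 1) ξ)) =
      P.map (fun ξ => ((fun s : ℤ => W s ξ), (fun s : Iic t => V s ξ))) ⊗ₘ
        (κ t).comap (fun h : (ℤ → Ω) × (Iic t → Ω) => h.2 ⟨t, self_mem_Iic⟩)
          ((measurable_pi_apply (⟨t, self_mem_Iic⟩ : Iic t)).comp measurable_snd)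

/-- Markov `q`-convexity of a metric space `M`. State spaces are arbitrary measurable spaces;
strong measurability of `f` makes the expectations meaningful, and it holds for every
`f : Ω → M` if `Ω` is countable with measurable points. `V τ` is the process which follows `W` up
to time `τ` and evolves independently afterwards. Both sides are sums in `[0, ∞]`. -/
def IsMarkovConvex (q : ℝ) (M : Type u) [MetricSpace M] : Prop :=
  ∃ C : ℝ, 0 < C ∧
    ∀ (Ω S : Type v) [MeasurableSpace Ω] [MeasurableSpace S]
      (P : Measure S) [IsProbabilityMeasure P]
      (κ : ℤ → Kernel Ω Ω) [∀ t, IsMarkovKernel (κ t)]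
      (W : ℤ → S → Ω) (V : ℤ → ℤ → S → Ω) (f : Ω → M),
      IsMarkovChain κ P W → (∀ τ, IsResampledAfter κ P W τ (V τ)) → StronglyMeasurable f →
      ∑' (s : ℕ) (t : ℤ),
          (∫⁻ ξ, edist (f (W t ξ)) (f (V (t - 2 ^ s) t ξ)) ^ q ∂P) / (2 : ℝ≥0∞) ^ ((s : ℝ) * q) ≤
        ENNReal.ofReal (C ^ q) * ∑' t : ℤ, ∫⁻ ξ, edist (f (W t ξ)) (f (W (t - 1) ξ)) ^ q ∂P

/-! ### Horizontal curves and the Carnot-Caratheodory distance -/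

/-! The distance is replaced by the comparable left-invariant quantity `ρ(a, b) = N(a⁻¹ * b)`, where
`N(x, s) = ‖x‖ ^ (2p) + lam * |s| ^ p` is `quasiNormPow`. It satisfies a fork inequality: for a stem
from `x` to `y` and two prongs from `y` to `z` and `w`, `2 (ρ(x,z) + ρ(x,w) + c ρ(z,w)) ≤ 2 ^ (2p)
(ρ(y,z) + ρ(y,w) + 2 ρ(x,y))`.

The fork inequality gives Markov convexity (`isMarkovConvex_of_fork`): put a state at time `t - 2 ^
(s+1)` in `x`, the branching state at time `t - 2 ^ s` in `y`, and the two continuations at time `t`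
in `z` and `w`. Integrating and summing over `t` yields a recursion from scale `s` to scale `s + 1`,
which telescopes.

The fork inequality itself (`quasiNormPow_mul_le`, `quasiNormPow_inv_mul_le`) rests on squaring the
uniform convexity inequality. The square contains the cross term `‖u + v‖ ^ p * ‖u - v‖ ^ p`. Since
`2 ω(u, v) = ω(u + v, v - u)`, this is exactly what bounds the contribution of `ω` to the height of
a product. For small `lam` the cross term absorbs that contribution, and what is left over controls
the distance between the tips of the prongs.

For the comparison of `N` with the `2p`-th power of the distance, commutators of segments give the
upper bound (`exists_ccDist_le`), and the height of a horizontal curve is at most `‖ω‖` times its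
squared length (`IsHorizontalCurve.abs_height_le`). -/

/-- Affine reparametrizations preserve null sets, so almost-everywhere horizontality survives
reversal and concatenation of curves. -/
theorem ae_comp_mul_add {q : ℝ → Prop} (h : ∀ᵐ t, q t) {m : ℝ} (hm : m ≠ 0) (c : ℝ) :
    ∀ᵐ t, q (m * t + c) := by
  have h1 : ∀ᵐ t, q (t + c) :=
    (measurePreserving_add_right volume c).quasiMeasurePreserving.ae h
  exact (Measure.quasiMeasurePreserving_smul (volume : Measure ℝ) hm).ae h1

theorem LipschitzOnWith.eVariationOn_Icc_le {E : Type*} [PseudoEMetricSpace E] {f : ℝ → E}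
    {C : ℝ≥0} {a b : ℝ} (hab : a ≤ b) (hf : LipschitzOnWith C f (Icc a b)) :
    eVariationOn f (Icc a b) ≤ C * ENNReal.ofReal (b - a) := by
  refine (hf.comp_eVariationOn_le (g := id) (mapsTo_id _)).trans ?_
  gcongr
  have := (monotoneOn_id (s := Icc a b)).eVariationOn_eq
    (left_mem_Icc.2 hab) (right_mem_Icc.2 hab)
  rw [inter_self] at this
  exact this.le

/-- The concatenation of two curves parametrized by `[0, 1]`. -/
noncomputable def curveConcat {E : Type*} (f g : ℝ → E) (t : ℝ) : E :=
  if t ≤ 1 / 2 then f (2 * t) else g (2 * t - 1)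

/-! ### Regularity and length of concatenated curves -/

section Concat

variable {E : Type*} {f g : ℝ → E}

theorem curveConcat_of_le {t : ℝ} (ht : t ≤ 1 / 2) : curveConcat f g t = f (2 * t) := if_pos ht

theorem curveConcat_of_ge (hfg : f 1 = g 0) {t : ℝ} (ht : 1 / 2 ≤ t) :
    curveConcat f g t = g (2 * t - 1) := by
  rcases ht.eq_or_lt with rfl | h
  · simp [curveConcat, hfg]
  · exact if_neg (not_le.2 h)

theorem LipschitzOnWith.curveConcat [PseudoMetricSpace E] {C D : ℝ≥0}
    (hf : LipschitzOnWith C f (Icc 0 1)) (hg : LipschitzOnWith D g (Icc 0 1)) (hfg : f 1 = g 0) :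
    LipschitzOnWith (2 * (C + D)) (curveConcat f g) (Icc 0 1) := by
  have key : ∀ s ∈ Icc (0 : ℝ) 1, ∀ t ∈ Icc (0 : ℝ) 1, s ≤ t →
      dist (_root_.curveConcat f g s) (_root_.curveConcat f g t) ≤ 2 * (C + D) * (t - s) := by
    intro s hs t ht hst
    have hf' : ∀ x ∈ Icc (0 : ℝ) 1, ∀ y ∈ Icc (0 : ℝ) 1, x ≤ y →
        dist (f x) (f y) ≤ (C + D) * (y - x) := fun x hx y hy hxy => by
      have := hf.dist_le_mul x hx y hy
      rw [dist_comm x y, Real.dist_eq, abs_of_nonneg (sub_nonneg.2 hxy)] at this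
      nlinarith [D.coe_nonneg]
    have hg' : ∀ x ∈ Icc (0 : ℝ) 1, ∀ y ∈ Icc (0 : ℝ) 1, x ≤ y →
        dist (g x) (g y) ≤ (C + D) * (y - x) := fun x hx y hy hxy => by
      have := hg.dist_le_mul x hx y hy
      rw [dist_comm x y, Real.dist_eq, abs_of_nonneg (sub_nonneg.2 hxy)] at this
      nlinarith [C.coe_nonneg]
    rcases le_total t (1 / 2) with h | h
    · rw [curveConcat_of_le h, curveConcat_of_le (hst.trans h)]
      refine (hf' _ ⟨?_, ?_⟩ _ ⟨?_, ?_⟩ ?_).trans_eq (by ring) <;> linarith [hs.1]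
    rcases le_total s (1 / 2) with h' | h'
    · rw [curveConcat_of_ge hfg h, curveConcat_of_le h']
      have h1 := hf' (2 * s) ⟨by linarith [hs.1], by linarith⟩ 1 ⟨zero_le_one, le_rfl⟩ (by linarith)
      have h2 := hg' 0 ⟨le_rfl, zero_le_one⟩ (2 * t - 1) ⟨by linarith, by linarith [ht.2]⟩
        (by linarith)
      have h3 := dist_triangle (f (2 * s)) (f 1) (g (2 * t - 1))
      rw [hfg] at h1 h3
      linarith
    · rw [curveConcat_of_ge hfg h, curveConcat_of_ge hfg h']
      refine (hg' _ ⟨?_, ?_⟩ _ ⟨?_, ?_⟩ ?_).trans_eq (by ring) <;> linarith [ht.2]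
  refine LipschitzOnWith.of_dist_le_mul fun s hs t ht => ?_
  push_cast
  rcases le_total s t with h | h
  · rw [dist_comm s t, Real.dist_eq, abs_of_nonneg (sub_nonneg.2 h)]
    exact key s hs t ht h
  · rw [dist_comm (_root_.curveConcat f g s), Real.dist_eq, abs_of_nonneg (sub_nonneg.2 h)]
    exact key t ht s hs h

theorem eVariationOn_curveConcat [PseudoEMetricSpace E] (hfg : f 1 = g 0) :
    eVariationOn (curveConcat f g) (Icc 0 1) =
      eVariationOn f (Icc 0 1) + eVariationOn g (Icc 0 1) := by
  have h := eVariationOn.Icc_add_Icc (curveConcat f g) (s := univ) (a := 0) (b := 1 / 2) (c := 1)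
    (by norm_num) (by norm_num) (mem_univ _)
  simp only [univ_inter] at h
  rw [← h]
  have h1 : (fun t : ℝ => 2 * t) '' Icc 0 (1 / 2) = Icc 0 1 := by
    rw [image_mul_left_Icc (by norm_num) (by norm_num)]; norm_num
  have h2 : (fun t : ℝ => 2 * t - 1) '' Icc (1 / 2) 1 = Icc 0 1 := by
    have : (fun t : ℝ => 2 * t - 1) = fun t : ℝ => 2 * t + (-1) := by ext; ring
    rw [this, image_affine_Icc' (by norm_num)]; norm_num
  congr 1
  · rw [← h1, ← eVariationOn.comp_eq_of_monotoneOn]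
    · exact eVariationOn.congr fun t ht => curveConcat_of_le ht.2
    · intro a _ b _ hab; simpa using hab
  · rw [← h2, ← eVariationOn.comp_eq_of_monotoneOn]
    · exact eVariationOn.congr fun t ht => curveConcat_of_ge hfg ht.1
    · intro a _ b _ hab; simpa using hab

end Concat

/-! ### Reversal and concatenation of horizontal curves: symmetry and triangle inequality -/

section Curves

variable {X : Type u} [NormedAddCommGroup X] [NormedSpace ℝ X] {ω : X →L[ℝ] X →L[ℝ] ℝ}

theorem isHorizontalCurve_ae {γ : ℝ → X} {z : ℝ → ℝ} (h : IsHorizontalCurve ω γ z) :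
    ∀ᵐ t : ℝ, t ∈ Icc (0 : ℝ) 1 →
      ∃ γ' : X, HasDerivAt γ γ' t ∧ HasDerivAt z (ω (γ t) γ') t :=
  (ae_restrict_iff' measurableSet_Icc).1 h.horizontal

theorem IsHorizontalCurve.reverse {γ : ℝ → X} {z : ℝ → ℝ} (h : IsHorizontalCurve ω γ z) :
    IsHorizontalCurve ω (fun t => γ (1 - t)) (fun t => z (1 - t)) := by
  have hl : LipschitzOnWith 1 (fun t : ℝ => 1 - t) (Icc 0 1) :=
    LipschitzOnWith.of_dist_le_mul fun s _ t _ => by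
      rw [dist_sub_left, NNReal.coe_one, one_mul]
  have hm : MapsTo (fun t : ℝ => 1 - t) (Icc 0 1) (Icc 0 1) := fun t ht =>
    ⟨by linarith [ht.2], by linarith [ht.1]⟩
  refine ⟨?_, ?_, (ae_restrict_iff' measurableSet_Icc).2 ?_⟩
  · obtain ⟨C, hC⟩ := h.lipschitz_base
    exact ⟨_, hC.comp hl hm⟩
  · obtain ⟨C, hC⟩ := h.lipschitz_height
    exact ⟨_, hC.comp hl hm⟩
  · filter_upwards [ae_comp_mul_add (isHorizontalCurve_ae h) (m := -1) (by norm_num) 1] with t ht ht1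
    have e : -1 * t + 1 = 1 - t := by ring
    rw [e] at ht
    obtain ⟨γ', h1, h2⟩ := ht (hm ht1)
    refine ⟨-γ', ?_, ?_⟩
    · simpa using h1.comp_const_sub 1 t
    · simpa using h2.comp_const_sub 1 t

theorem IsHorizontalCurve.curveConcat {γ₁ γ₂ : ℝ → X} {z₁ z₂ : ℝ → ℝ}
    (h₁ : IsHorizontalCurve ω γ₁ z₁) (h₂ : IsHorizontalCurve ω γ₂ z₂)
    (hγ : γ₁ 1 = γ₂ 0) (hz : z₁ 1 = z₂ 0) :
    IsHorizontalCurve ω (curveConcat γ₁ γ₂) (curveConcat z₁ z₂) := by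
  obtain ⟨C, hC⟩ := h₁.lipschitz_base
  obtain ⟨C', hC'⟩ := h₂.lipschitz_base
  obtain ⟨D, hD⟩ := h₁.lipschitz_height
  obtain ⟨D', hD'⟩ := h₂.lipschitz_height
  refine ⟨⟨_, hC.curveConcat hC' hγ⟩, ⟨_, hD.curveConcat hD' hz⟩,
    (ae_restrict_iff' measurableSet_Icc).2 ?_⟩
  filter_upwards [ae_comp_mul_add (isHorizontalCurve_ae h₁) (m := 2) (by norm_num) 0,
    ae_comp_mul_add (isHorizontalCurve_ae h₂) (m := 2) (by norm_num) (-1),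
    Measure.ae_ne volume (1 / 2 : ℝ)] with t ht₁ ht₂ hne ht
  rw [add_zero] at ht₁
  rw [← sub_eq_add_neg] at ht₂
  rcases lt_or_gt_of_ne hne with hlt | hgt
  · obtain ⟨γ', h1, h2⟩ := ht₁ ⟨by linarith [ht.1], by linarith⟩
    have hd : HasDerivAt (fun t : ℝ => 2 * t) 2 t := by
      simpa using (hasDerivAt_id t).const_mul (2 : ℝ)
    have hev : ∀ᶠ s in nhds t, s ≤ 1 / 2 := (eventually_lt_nhds hlt).mono fun _ => le_of_lt
    refine ⟨(2 : ℝ) • γ', ?_, ?_⟩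
    · exact (h1.scomp t hd).congr_of_eventuallyEq (hev.mono fun s hs => curveConcat_of_le hs)
    · rw [curveConcat_of_le hlt.le]
      have := (h2.scomp t hd).congr_of_eventuallyEq (f₁ := _root_.curveConcat z₁ z₂)
        (hev.mono fun s hs => curveConcat_of_le hs)
      simpa using this
  · obtain ⟨γ', h1, h2⟩ := ht₂ ⟨by linarith, by linarith [ht.2]⟩
    have hd : HasDerivAt (fun t : ℝ => 2 * t - 1) 2 t := by
      simpa using ((hasDerivAt_id t).const_mul (2 : ℝ)).sub_const 1
    have hev : ∀ᶠ s in nhds t, 1 / 2 ≤ s := (eventually_gt_nhds hgt).mono fun _ => le_of_lt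
    refine ⟨(2 : ℝ) • γ', ?_, ?_⟩
    · exact (h1.scomp t hd).congr_of_eventuallyEq (hev.mono fun s hs => curveConcat_of_ge hγ hs)
    · rw [curveConcat_of_ge hγ hgt.le]
      have := (h2.scomp t hd).congr_of_eventuallyEq (f₁ := _root_.curveConcat z₁ z₂)
        (hev.mono fun s hs => curveConcat_of_ge hz hs)
      simpa using this

theorem ccDist_comm_le (a b : HeisenbergGroup ω) : ccDist ω b a ≤ ccDist ω a b := by
  refine le_sInf ?_
  rintro _ ⟨γ, z, h, h1, h2, h3, h4, rfl⟩
  refine sInf_le ⟨_, _, h.reverse, by simpa using h3, by simpa using h4, by simpa using h1,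
    by simpa using h2, ?_⟩
  have : (fun t : ℝ => 1 - t) '' Icc 0 1 = Icc 0 1 := by simp
  conv_lhs => rw [← this]
  rw [← eVariationOn.comp_eq_of_antitoneOn]
  · rfl
  · intro s _ t _ hst
    exact sub_le_sub_left hst 1

theorem ccDist_comm (a b : HeisenbergGroup ω) : ccDist ω a b = ccDist ω b a :=
  le_antisymm (ccDist_comm_le b a) (ccDist_comm_le a b)

theorem ccDist_triangle (a b c : HeisenbergGroup ω) :
    ccDist ω a c ≤ ccDist ω a b + ccDist ω b c := by
  unfold ccDist
  rw [ENNReal.sInf_add]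
  refine le_iInf₂ ?_
  rintro _ ⟨γ, z, h, h1, h2, h3, h4, rfl⟩
  rw [add_comm, ENNReal.sInf_add]
  refine le_iInf₂ ?_
  rintro _ ⟨γ₂, z₂, h', h1', h2', h3', h4', rfl⟩
  have hγ : γ 1 = γ₂ 0 := h3.trans h1'.symm
  have hz : z 1 = z₂ 0 := h4.trans h2'.symm
  refine sInf_le ⟨_, _, h.curveConcat h' hγ hz, ?_, ?_, ?_, ?_, ?_⟩
  · rw [curveConcat_of_le (by norm_num), mul_zero, h1]
  · rw [curveConcat_of_le (by norm_num), mul_zero, h2]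
  · rw [curveConcat_of_ge hγ (by norm_num), ← h3']; norm_num
  · rw [curveConcat_of_ge hz (by norm_num), ← h4']; norm_num
  · rw [eVariationOn_curveConcat hγ, add_comm]

/-! ### Upper bounds for the distance by explicit curves -/

namespace HeisenbergGroup

@[simp] theorem base_mul (a b : HeisenbergGroup ω) : (a * b).base = a.base + b.base := rfl
@[simp] theorem height_mul (a b : HeisenbergGroup ω) :
    (a * b).height = a.height + b.height + ω a.base b.base := rfl
@[simp] theorem base_inv (a : HeisenbergGroup ω) : a⁻¹.base = -a.base := rfl
@[simp] theorem height_inv (a : HeisenbergGroup ω) :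
    a⁻¹.height = ω a.base a.base - a.height := rfl

end HeisenbergGroup

/-- The straight segment in direction `v` lifts with linear height, because `ω (a.base + t • v) v =
ω a.base v`. -/
theorem ccDist_mul_horizontal_le (hself : ∀ x, ω x x = 0) (a : HeisenbergGroup ω) (v : X) :
    ccDist ω a (a * ⟨v, 0⟩) ≤ ‖v‖ₑ := by
  have hl : LipschitzOnWith ‖v‖₊ (fun t : ℝ => a.base + t • v) (Icc 0 1) :=
    LipschitzOnWith.of_dist_le_mul fun s _ t _ => by
      rw [dist_add_left, dist_eq_norm, ← sub_smul, norm_smul, mul_comm, dist_eq_norm]; rfl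
  have hb : ∀ t : ℝ, HasDerivAt (fun t : ℝ => a.base + t • v) v t := fun t => by
    simpa using ((hasDerivAt_id t).smul_const v).const_add a.base
  have hh : ∀ t : ℝ, HasDerivAt (fun t : ℝ => a.height + t * ω a.base v) (ω a.base v) t :=
    fun t => by simpa using ((hasDerivAt_id t).mul_const (ω a.base v)).const_add a.height
  have hcurve : IsHorizontalCurve ω (fun t : ℝ => a.base + t • v)
      (fun t : ℝ => a.height + t * ω a.base v) := by
    refine ⟨⟨_, hl⟩, ⟨‖ω a.base v‖₊, LipschitzOnWith.of_dist_le_mul fun s _ t _ => ?_⟩,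
      Filter.Eventually.of_forall fun t => ⟨v, hb t, ?_⟩⟩
    · rw [dist_add_left, dist_eq_norm, ← sub_mul, norm_mul, mul_comm, dist_eq_norm]; rfl
    · convert hh t using 1
      simp [hself]
  have hle : ccDist ω a (a * ⟨v, 0⟩) ≤ eVariationOn (fun t : ℝ => a.base + t • v) (Icc 0 1) := by
    refine sInf_le ⟨_, _, hcurve, ?_, ?_, ?_, ?_, rfl⟩ <;> simp
  refine hle.trans ((hl.eVariationOn_Icc_le zero_le_one).trans ?_)
  simp [enorm]

theorem ccDist_self (hself : ∀ x, ω x x = 0) (a : HeisenbergGroup ω) : ccDist ω a a = 0 := by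
  have h := ccDist_mul_horizontal_le hself a 0
  have e : (⟨0, 0⟩ : HeisenbergGroup ω) = 1 := rfl
  rw [e, mul_one] at h
  simpa using h

/-- A commutator of horizontal segments realizes a vertical displacement. -/
theorem ccDist_mul_vertical_le (hself : ∀ x, ω x x = 0) (hanti : ∀ x y, ω x y = -ω y x)
    (a : HeisenbergGroup ω) (e f : X) :
    ccDist ω a (a * ⟨0, 2 * ω e f⟩) ≤ 2 * (‖e‖ₑ + ‖f‖ₑ) := by
  have h1 := ccDist_mul_horizontal_le hself a e
  have h2 := ccDist_mul_horizontal_le hself (a * ⟨e, 0⟩) f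
  have h3 := ccDist_mul_horizontal_le hself (a * ⟨e, 0⟩ * ⟨f, 0⟩) (-e)
  have h4 := ccDist_mul_horizontal_le hself (a * ⟨e, 0⟩ * ⟨f, 0⟩ * ⟨-e, 0⟩) (-f)
  have heq : a * ⟨e, 0⟩ * ⟨f, 0⟩ * ⟨-e, 0⟩ * ⟨-f, 0⟩ = a * ⟨0, 2 * ω e f⟩ := by
    refine HeisenbergGroup.ext ?_ ?_
    · simp only [HeisenbergGroup.base_mul]; abel
    · simp [hself]
      rw [hanti f e]; ring
  rw [heq] at h4
  rw [enorm_neg] at h3 h4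
  have t1 := ccDist_triangle a (a * ⟨e, 0⟩) (a * ⟨e, 0⟩ * ⟨f, 0⟩)
  have t2 := ccDist_triangle a (a * ⟨e, 0⟩ * ⟨f, 0⟩) (a * ⟨e, 0⟩ * ⟨f, 0⟩ * ⟨-e, 0⟩)
  have t3 := ccDist_triangle a (a * ⟨e, 0⟩ * ⟨f, 0⟩ * ⟨-e, 0⟩) (a * ⟨0, 2 * ω e f⟩)
  calc ccDist ω a (a * ⟨0, 2 * ω e f⟩)
      ≤ ‖e‖ₑ + ‖f‖ₑ + ‖e‖ₑ + ‖f‖ₑ :=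
        t3.trans (add_le_add (t2.trans (add_le_add (t1.trans (add_le_add h1 h2)) h3)) h4)
    _ = 2 * (‖e‖ₑ + ‖f‖ₑ) := by ring

/-- The Carnot-Caratheodory distance is bounded by the homogeneous quasi-norm. -/
theorem exists_ccDist_le (hanti : ∀ x y, ω x y = -ω y x) (hω : ω ≠ 0) :
    ∃ C : ℝ, 0 ≤ C ∧ ∀ a b : HeisenbergGroup ω,
      ccDist ω a b ≤ ENNReal.ofReal (‖(a⁻¹ * b).base‖ + C * √|(a⁻¹ * b).height|) := by
  have hself : ∀ x, ω x x = 0 := fun x => by linarith [hanti x x]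
  obtain ⟨e, f, hef⟩ : ∃ e f, ω e f = 1 := by
    obtain ⟨e, he⟩ : ∃ e, ω e ≠ 0 := by
      by_contra! h
      exact hω (ContinuousLinearMap.ext fun x => by simpa using h x)
    obtain ⟨f, hf⟩ : ∃ f, ω e f ≠ 0 := by
      by_contra! h
      exact he (ContinuousLinearMap.ext fun x => by simpa using h x)
    exact ⟨e, (ω e f)⁻¹ • f, by simp [hf]⟩
  refine ⟨2 * (‖e‖ + ‖f‖), by positivity, fun a b => ?_⟩
  obtain ⟨g, rfl⟩ : ∃ g, b = a * g := ⟨a⁻¹ * b, by simp⟩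
  rw [inv_mul_cancel_left]
  obtain ⟨x, h⟩ := g
  dsimp only
  have hmul : a * ⟨x, h⟩ = a * ⟨x, 0⟩ * ⟨0, h⟩ := by
    rw [mul_assoc]; congr 1
    refine HeisenbergGroup.ext ?_ ?_ <;> simp
  have hvert : ∀ c : HeisenbergGroup ω,
      ccDist ω c (c * ⟨0, h⟩) ≤ ENNReal.ofReal (2 * (‖e‖ + ‖f‖) * √|h|) := by
    intro c
    set r : ℝ := √|h| with hr
    have hr0 : 0 ≤ r := Real.sqrt_nonneg _
    have hrr : r * r = |h| := Real.mul_self_sqrt (abs_nonneg _)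
    have hbound : 2 * (‖r • e‖ₑ + ‖f‖ₑ * ‖r‖ₑ) ≤ ENNReal.ofReal (2 * (‖e‖ + ‖f‖) * r) := by
      rw [enorm_smul, ← ofReal_norm r, ← ofReal_norm e, ← ofReal_norm f,
        Real.norm_of_nonneg hr0, ← ENNReal.ofReal_mul hr0, ← ENNReal.ofReal_mul (norm_nonneg _),
        ← ENNReal.ofReal_add (by positivity) (by positivity),
        show (2 : ℝ≥0∞) = ENNReal.ofReal 2 by simp, ← ENNReal.ofReal_mul (by norm_num)]
      exact ENNReal.ofReal_le_ofReal (le_of_eq (by ring))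
    rcases le_total 0 h with h0 | h0
    -- The commutator of `r • e` and `(r / 2) • f` has height `2 * r * (r / 2) = |h|`; for negative
    -- `h` the two factors are swapped.
    · have h1 := ccDist_mul_vertical_le hself hanti c (r • e) ((r / 2) • f)
      have e1 : 2 * ω (r • e) ((r / 2) • f) = h := by
        rw [abs_of_nonneg h0] at hrr
        simp only [map_smul, smul_apply, smul_eq_mul, hef]
        linarith
      rw [e1] at h1
      refine h1.trans (le_trans ?_ hbound)
      gcongr
      rw [enorm_smul, mul_comm]
      gcongr
      rw [← ofReal_norm, ← ofReal_norm]
      apply ENNReal.ofReal_le_ofReal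
      rw [Real.norm_of_nonneg hr0, Real.norm_of_nonneg (by positivity)]
      linarith
    · have h1 := ccDist_mul_vertical_le hself hanti c ((r / 2) • f) (r • e)
      have e1 : 2 * ω ((r / 2) • f) (r • e) = h := by
        rw [abs_of_nonpos h0] at hrr
        rw [hanti]
        simp only [map_smul, smul_apply, smul_eq_mul, hef]
        linarith
      rw [e1, add_comm] at h1
      refine h1.trans (le_trans ?_ hbound)
      gcongr
      rw [enorm_smul, mul_comm]
      gcongr
      rw [← ofReal_norm, ← ofReal_norm]
      apply ENNReal.ofReal_le_ofReal
      rw [Real.norm_of_nonneg hr0, Real.norm_of_nonneg (by positivity)]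
      linarith
  rw [ENNReal.ofReal_add (norm_nonneg _) (by positivity), hmul, ofReal_norm]
  exact (ccDist_triangle _ (a * ⟨x, 0⟩) _).trans
    (add_le_add (ccDist_mul_horizontal_le hself a x) (hvert _))

end Curves

/-! ### Lower bounds for the distance, and the metric -/

section LowerBound

theorem LipschitzOnWith.le_of_ae_deriv_nonpos {f : ℝ → ℝ} {C : ℝ≥0} {a b : ℝ} (hab : a ≤ b)
    (hf : LipschitzOnWith C f (Icc a b)) (hd : ∀ᵐ t, t ∈ Icc a b → deriv f t ≤ 0) :
    f b ≤ f a := by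
  have hac : AbsolutelyContinuousOnInterval f a b := by
    refine LipschitzOnWith.absolutelyContinuousOnInterval (K := C) ?_
    rwa [uIcc_of_le hab]
  have h := hac.integral_deriv_eq_sub
  have h2 : 0 ≤ ∫ t in a..b, -deriv f t := by
    refine intervalIntegral.integral_nonneg_of_ae_restrict hab ?_
    refine (ae_restrict_iff' measurableSet_Icc).2 ?_
    filter_upwards [hd] with t ht hmem
    simpa using ht hmem
  rw [intervalIntegral.integral_neg, h] at h2
  linarith

theorem dist_le_variationOnFromTo {E : Type*} [PseudoMetricSpace E] {f : ℝ → E} {s : Set ℝ}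
    (hf : LocallyBoundedVariationOn f s) {a b : ℝ} (ha : a ∈ s) (hb : b ∈ s) (hab : a ≤ b) :
    dist (f a) (f b) ≤ variationOnFromTo f s a b := by
  rw [variationOnFromTo.eq_of_le f s hab, dist_edist]
  exact ENNReal.toReal_mono (hf a b ha hb)
    (eVariationOn.edist_le f ⟨ha, le_rfl, hab⟩ ⟨hb, hab, le_rfl⟩)

theorem LipschitzOnWith.variationOnFromTo {E : Type*} [PseudoMetricSpace E] {f : ℝ → E}
    {C : ℝ≥0} {a b : ℝ} (hab : a ≤ b) (hf : LipschitzOnWith C f (Icc a b)) :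
    LipschitzOnWith C (variationOnFromTo f (Icc a b) a) (Icc a b) := by
  have hlb := hf.locallyBoundedVariationOn
  have ha := left_mem_Icc.2 hab
  have key : ∀ s ∈ Icc a b, ∀ t ∈ Icc a b, s ≤ t →
      dist (_root_.variationOnFromTo f (Icc a b) a t) (_root_.variationOnFromTo f (Icc a b) a s)
        ≤ C * dist t s := by
    intro s hs t ht hst
    rw [Real.dist_eq, Real.dist_eq, variationOnFromTo.sub_right hlb ha ht hs,
      abs_of_nonneg (variationOnFromTo.nonneg_of_le _ _ hst), abs_of_nonneg (sub_nonneg.2 hst),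
      variationOnFromTo.eq_of_le _ _ hst, inter_eq_right.2 (Icc_subset_Icc hs.1 ht.2)]
    refine ENNReal.toReal_le_of_le_ofReal (mul_nonneg C.coe_nonneg (sub_nonneg.2 hst)) ?_
    rw [ENNReal.ofReal_mul C.coe_nonneg]
    exact ((hf.mono (Icc_subset_Icc hs.1 ht.2)).eVariationOn_Icc_le hst).trans_eq (by simp)
  refine LipschitzOnWith.of_dist_le_mul fun s hs t ht => ?_
  rcases le_total s t with h | h
  · rw [dist_comm, dist_comm s]
    exact key s hs t ht h
  · exact key t ht s hs h

variable {X : Type u} [NormedAddCommGroup X] [NormedSpace ℝ X] {ω : X →L[ℝ] X →L[ℝ] ℝ}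

theorem IsHorizontalCurve.neg {γ : ℝ → X} {z : ℝ → ℝ} (h : IsHorizontalCurve ω γ z) :
    IsHorizontalCurve (-ω) γ (fun t => -z t) := by
  refine ⟨h.lipschitz_base, ?_, ?_⟩
  · obtain ⟨C, hC⟩ := h.lipschitz_height
    exact ⟨C, hC.neg⟩
  · filter_upwards [h.horizontal] with t ht
    obtain ⟨γ', h1, h2⟩ := ht
    refine ⟨γ', h1, ?_⟩
    rw [show (-ω) (γ t) γ' = -ω (γ t) γ' from rfl]
    exact h2.neg

/-- After translation to the origin the height `d` has derivative `ω (γ t - γ 0) γ'`, at most `‖ω‖ *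
V * ‖γ'‖` with `V` the total length. Comparing `d` with `‖ω‖ * V` times the arc length `v` avoids
integrating `‖γ'‖`: it suffices that the Lipschitz function `d - ‖ω‖ * V * v` has nonpositive
derivative almost everywhere. -/
theorem IsHorizontalCurve.height_le {γ : ℝ → X} {z : ℝ → ℝ} (h : IsHorizontalCurve ω γ z) :
    z 1 - z 0 - ω (γ 0) (γ 1 - γ 0) ≤ ‖ω‖ * (eVariationOn γ (Icc 0 1)).toReal ^ 2 := by
  obtain ⟨C, hC⟩ := h.lipschitz_base
  obtain ⟨D, hD⟩ := h.lipschitz_height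
  have hlb := hC.locallyBoundedVariationOn
  have h0 : (0 : ℝ) ∈ Icc (0 : ℝ) 1 := ⟨le_rfl, zero_le_one⟩
  have h1 : (1 : ℝ) ∈ Icc (0 : ℝ) 1 := ⟨zero_le_one, le_rfl⟩
  set v := variationOnFromTo γ (Icc 0 1) 0 with hv
  set V := (eVariationOn γ (Icc 0 1)).toReal with hV
  have hv0 : v 0 = 0 := variationOnFromTo.self _ _ _
  have hv1 : v 1 = V := by
    rw [hv, variationOnFromTo.eq_of_le _ _ zero_le_one, inter_self]
  have hV0 : 0 ≤ V := ENNReal.toReal_nonneg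
  set d : ℝ → ℝ := fun t => z t - z 0 - ω (γ 0) (γ t - γ 0) with hd
  have hdist : ∀ t ∈ Icc (0 : ℝ) 1, ‖γ t - γ 0‖ ≤ V := fun t ht => by
    rw [← dist_eq_norm, dist_comm]
    refine (dist_le_variationOnFromTo hlb h0 ht ht.1).trans ?_
    rw [← hv1]
    exact variationOnFromTo.monotoneOn hlb h0 ht h1 ht.2
  obtain ⟨A, hA⟩ : ∃ A, LipschitzOnWith A (fun t => d t - ‖ω‖ * V * v t) (Icc 0 1) := by
    have hl : LipschitzOnWith (‖ω (γ 0)‖₊ * C) (fun t => ω (γ 0) (γ t)) (Icc 0 1) :=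
      (ω (γ 0)).lipschitz.comp_lipschitzOnWith hC
    have hw : LipschitzOnWith (‖‖ω‖ * V‖₊ * C) (fun t => ‖ω‖ * V * v t) (Icc 0 1) :=
      (LipschitzWith.of_dist_le_mul (K := ‖‖ω‖ * V‖₊) (f := fun x : ℝ => ‖ω‖ * V * x)
        fun x y => by rw [dist_eq_norm, dist_eq_norm, ← mul_sub, norm_mul]; rfl).comp_lipschitzOnWith
        (hC.variationOnFromTo zero_le_one)
    have := ((hD.sub hl).sub hw).sub 
      (LipschitzWith.const (z 0 - ω (γ 0) (γ 0))).lipschitzOnWith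
    have e : (fun t => d t - ‖ω‖ * V * v t) =
        fun t => z t - ω (γ 0) (γ t) - ‖ω‖ * V * v t - (z 0 - ω (γ 0) (γ 0)) := by
      ext t
      simp only [hd, map_sub]
      ring
    exact ⟨_, e ▸ this⟩
  have key := hA.le_of_ae_deriv_nonpos zero_le_one ?_
  · simp only [hd, hv0, hv1, sub_self, map_zero, mul_zero] at key
    linarith [sq V]
  filter_upwards [isHorizontalCurve_ae h, Measure.ae_ne volume (1 : ℝ)] with t ht hne htm
  obtain ⟨γ', hγ, hz⟩ := ht htm
  by_cases hdiff : DifferentiableAt ℝ (fun t => d t - ‖ω‖ * V * v t) t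
  swap
  -- At such points `deriv` takes its default value `0`.
  · rw [deriv_zero_of_not_differentiableAt hdiff]
  have hg := hdiff.hasDerivAt
  have hdd : HasDerivAt d (ω (γ t) γ' - ω (γ 0) γ') t :=
    (hz.sub_const _).sub ((ω (γ 0)).hasFDerivAt.comp_hasDerivAt t (hγ.sub_const _))
  have hbound : ω (γ t) γ' - ω (γ 0) γ' - ‖ω‖ * V * ‖γ'‖ ≤ 0 := by
    have e : ω (γ t) γ' - ω (γ 0) γ' = ω (γ t - γ 0) γ' := by simp
    rw [e, sub_nonpos]
    refine (Real.le_norm_self _).trans ((ω.le_opNorm₂ _ _).trans ?_)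
    gcongr
    exact hdist t htm
  have s1 := hg.tendsto_slope.mono_left (nhdsGT_le_nhdsNE t)
  have s2 := hdd.tendsto_slope.mono_left (nhdsGT_le_nhdsNE t)
  have s3 := hγ.tendsto_slope.mono_left (nhdsGT_le_nhdsNE t)
  -- Only slopes of `v` are used, not its derivative: they dominate the norms of the slopes of `γ`.
  -- Right slopes stay inside `[0, 1]` because `t = 1` was discarded.
  refine (le_of_tendsto_of_tendsto s1 (s2.sub (s3.norm.const_mul (‖ω‖ * V))) ?_).trans hbound
  have hlt : t < 1 := lt_of_le_of_ne htm.2 hne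
  filter_upwards [Ioo_mem_nhdsGT hlt] with s hs
  have hsm : s ∈ Icc (0 : ℝ) 1 := ⟨htm.1.trans hs.1.le, hs.2.le⟩
  have hst : 0 < s - t := sub_pos.2 hs.1
  have hvs : ‖γ s - γ t‖ ≤ v s - v t := by
    rw [← dist_eq_norm, dist_comm, hv, variationOnFromTo.sub_right hlb h0 hsm htm]
    exact dist_le_variationOnFromTo hlb htm hsm hs.1.le
  have hM : 0 ≤ ‖ω‖ * V := by positivity
  rw [slope_def_module γ, norm_smul, Real.norm_of_nonneg (inv_nonneg.2 hst.le), slope_def_field,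
    slope_def_field, div_eq_inv_mul, div_eq_inv_mul]
  have := mul_le_mul_of_nonneg_left (mul_le_mul_of_nonneg_left hvs hM) (inv_nonneg.2 hst.le)
  linarith

/-- The other sign follows by applying the one-sided bound to `-ω` and `-z`. -/
theorem IsHorizontalCurve.abs_height_le {γ : ℝ → X} {z : ℝ → ℝ} (h : IsHorizontalCurve ω γ z) :
    |z 1 - z 0 - ω (γ 0) (γ 1 - γ 0)| ≤ ‖ω‖ * (eVariationOn γ (Icc 0 1)).toReal ^ 2 := by
  refine abs_le.2 ⟨?_, h.height_le⟩
  have := h.neg.height_le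
  rw [show ‖-ω‖ = ‖ω‖ from norm_neg ω] at this
  simp only [neg_apply] at this
  linarith

theorem enorm_base_le_ccDist (a b : HeisenbergGroup ω) : ‖(a⁻¹ * b).base‖ₑ ≤ ccDist ω a b := by
  refine le_sInf ?_
  rintro _ ⟨γ, z, h, h1, h2, h3, h4, rfl⟩
  have := eVariationOn.edist_le γ (s := Icc 0 1) (x := 1) (y := 0) (by simp) (by simp)
  rw [h1, h3, edist_eq_enorm_sub] at this
  simpa [neg_add_eq_sub] using this

theorem ofReal_sqrt_height_le_ccDist (hω : ω ≠ 0) (a b : HeisenbergGroup ω) :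
    ENNReal.ofReal √|(a⁻¹ * b).height| ≤ ENNReal.ofReal √‖ω‖ * ccDist ω a b := by
  have hpos : 0 < ‖ω‖ :=
    (ContinuousLinearMap.opNorm_nonneg ω).lt_of_ne fun h =>
      hω ((ContinuousLinearMap.opNorm_zero_iff ω).1 h.symm)
  rw [ccDist, sInf_eq_iInf', ENNReal.mul_iInf_of_ne (by simpa using hpos) ENNReal.ofReal_ne_top]
  refine le_iInf ?_
  rintro ⟨_, γ, z, h, h1, h2, h3, h4, rfl⟩
  dsimp only
  obtain ⟨C, hC⟩ := h.lipschitz_base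
  have hfin : eVariationOn γ (Icc 0 1) ≠ ⊤ :=
    ne_top_of_le_ne_top (by finiteness) (hC.eVariationOn_Icc_le zero_le_one)
  have hh : (a⁻¹ * b).height = z 1 - z 0 - ω (γ 0) (γ 1 - γ 0) := by
    rw [h1, h2, h3, h4]
    simp
    ring
  rw [← ENNReal.ofReal_toReal hfin, ← ENNReal.ofReal_mul (Real.sqrt_nonneg _), hh]
  apply ENNReal.ofReal_le_ofReal
  refine (Real.sqrt_le_sqrt h.abs_height_le).trans_eq ?_
  rw [Real.sqrt_mul hpos.le, Real.sqrt_sq ENNReal.toReal_nonneg]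

/-- The Carnot-Caratheodory distance as a metric. -/
@[reducible] noncomputable def ccMetricSpace (hanti : ∀ x y, ω x y = -ω y x) (hω : ω ≠ 0) :
    MetricSpace (HeisenbergGroup ω) :=
  letI : EMetricSpace (HeisenbergGroup ω) :=
    { edist := ccDist ω
      edist_self := ccDist_self fun x => by linarith [hanti x x]
      edist_comm := ccDist_comm
      edist_triangle := ccDist_triangle
      eq_of_edist_eq_zero := fun {a b} h => by
        replace h : ccDist ω a b = 0 := h
        have h1 := enorm_base_le_ccDist a b
        have h2 := ofReal_sqrt_height_le_ccDist hω a b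
        rw [h] at h1 h2
        have h3 : (a⁻¹ * b).base = 0 := by simpa using h1
        rw [mul_zero, nonpos_iff_eq_zero, ENNReal.ofReal_eq_zero, Real.sqrt_le_left le_rfl] at h2
        have h4 : (a⁻¹ * b).height = 0 := abs_nonpos_iff.1 (by simpa using h2)
        exact inv_mul_eq_one.1 (HeisenbergGroup.ext h3 h4) }
  EMetricSpace.toMetricSpace fun a b => by
    obtain ⟨C, -, hC⟩ := exists_ccDist_le hanti hω
    exact ne_top_of_le_ne_top ENNReal.ofReal_ne_top (hC a b)

theorem edist_ccMetricSpace (hanti : ∀ x y, ω x y = -ω y x) (hω : ω ≠ 0)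
    (a b : HeisenbergGroup ω) :
    (ccMetricSpace hanti hω).toPseudoMetricSpace.toPseudoEMetricSpace.edist a b = ccDist ω a b :=
  rfl

end LowerBound

/-! ### Markov convexity from a fork inequality -/

section Markov

variable {Ω S : Type v} [MeasurableSpace Ω] [MeasurableSpace S] {κ : ℤ → Kernel Ω Ω}
  [∀ t, IsMarkovKernel (κ t)] {P : Measure S} [IsProbabilityMeasure P] {W : ℤ → S → Ω}

/-- The kernel gives the conditional law given the whole past, so the test function may also depend
on an earlier state `W u`. -/
theorem IsMarkovChain.lintegral_succ (hW : IsMarkovChain κ P W) {u t : ℤ} (hut : u ≤ t)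
    {φ : Ω × Ω → ℝ≥0∞} (hφ : Measurable φ) :
    ∫⁻ ξ, φ (W u ξ, W (t + 1) ξ) ∂P = ∫⁻ ξ, ∫⁻ y, φ (W u ξ, y) ∂(κ t (W t ξ)) ∂P := by
  have hH : Measurable (fun ξ => (fun s : Iic t => W s ξ)) :=
    measurable_pi_lambda _ fun s => hW.measurable s
  let ψ : (Iic t → Ω) × Ω → ℝ≥0∞ := fun p => φ (p.1 ⟨u, hut⟩, p.2)
  have hψ : Measurable ψ :=
    hφ.comp (((measurable_pi_apply _).comp measurable_fst).prodMk measurable_snd)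
  have h1 : ∫⁻ ξ, φ (W u ξ, W (t + 1) ξ) ∂P =
      ∫⁻ x, ψ x ∂(P.map (fun ξ => ((fun s : Iic t => W s ξ), W (t + 1) ξ))) :=
    (lintegral_map hψ (hH.prodMk (hW.measurable _))).symm
  have := Measure.isProbabilityMeasure_map (μ := P) hH.aemeasurable
  rw [h1, hW.map_eq t, Measure.lintegral_compProd hψ, lintegral_map _ hH]
  · rfl
  · exact hψ.lintegral_kernel_prod_right'

theorem IsResampledAfter.lintegral_succ {τ : ℤ} {V : ℤ → S → Ω} (hW : IsMarkovChain κ P W)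
    (hV : IsResampledAfter κ P W τ V) (u : ℤ) {t : ℤ} (ht : τ ≤ t)
    {φ : Ω × Ω → ℝ≥0∞} (hφ : Measurable φ) :
    ∫⁻ ξ, φ (W u ξ, V (t + 1) ξ) ∂P = ∫⁻ ξ, ∫⁻ y, φ (W u ξ, y) ∂(κ t (V t ξ)) ∂P := by
  have hH : Measurable (fun ξ => ((fun s : ℤ => W s ξ), (fun s : Iic t => V s ξ))) :=
    (measurable_pi_lambda _ fun s => hW.measurable s).prodMk
      (measurable_pi_lambda _ fun s => hV.measurable s)
  let ψ : ((ℤ → Ω) × (Iic t → Ω)) × Ω → ℝ≥0∞ := fun p => φ (p.1.1 u, p.2)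
  have hψ : Measurable ψ :=
    hφ.comp (((measurable_pi_apply _).comp (measurable_fst.comp measurable_fst)).prodMk
      measurable_snd)
  have h1 : ∫⁻ ξ, φ (W u ξ, V (t + 1) ξ) ∂P =
      ∫⁻ x, ψ x ∂(P.map
        (fun ξ => (((fun s : ℤ => W s ξ), (fun s : Iic t => V s ξ)), V (t + 1) ξ))) :=
    (lintegral_map hψ (hH.prodMk (hV.measurable _))).symm
  have := Measure.isProbabilityMeasure_map (μ := P) hH.aemeasurable
  rw [h1, hV.map_eq t ht, Measure.lintegral_compProd hψ, lintegral_map _ hH]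
  · rfl
  · exact hψ.lintegral_kernel_prod_right'

/-- The resampled chain has the same joint law with the past as the original one. -/
theorem IsResampledAfter.lintegral_eq {τ : ℤ} {V : ℤ → S → Ω} (hW : IsMarkovChain κ P W)
    (hV : IsResampledAfter κ P W τ V) {u : ℤ} (hu : u ≤ τ) (n : ℕ) :
    ∀ φ : Ω × Ω → ℝ≥0∞, Measurable φ →
      ∫⁻ ξ, φ (W u ξ, V (τ + n) ξ) ∂P = ∫⁻ ξ, φ (W u ξ, W (τ + n) ξ) ∂P := by
  induction n with
  | zero =>
    intro φ _
    refine lintegral_congr_ae ?_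
    filter_upwards [hV.ae_eq_of_le (τ + (0 : ℕ)) (by simp)] with ξ hξ
    rw [hξ]
  | succ n ih =>
    intro φ hφ
    -- Averaging `φ` over the last step gives another measurable function of a pair, to which the
    -- induction hypothesis applies; this is why `φ` is quantified inside the induction.
    have hm : Measurable fun p : Ω × Ω => ∫⁻ y, φ (p.1, y) ∂(κ (τ + n) p.2) := by
      have := Measurable.lintegral_kernel_prod_right' (κ := (κ (τ + n)).comap
        (Prod.snd : Ω × Ω → Ω) measurable_snd) (f := fun p => φ (p.1.1, p.2))
        (hφ.comp ((measurable_fst.comp measurable_fst).prodMk measurable_snd))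
      exact this
    have e : τ + ((n + 1 : ℕ) : ℤ) = τ + n + 1 := by push_cast; ring
    rw [e, hV.lintegral_succ hW u (by omega) hφ, hW.lintegral_succ (by omega) hφ]
    exact ih _ hm

/-- In the integrated fork inequality with `x = W u`, `y = W τ`, `z = W t`, `w = V t`, every term
pairing `V t` with `W u` or `W τ` may be rewritten with `W t`, since these joint laws agree. Only
the tip term still contains `V`. -/
theorem IsResampledAfter.lintegral_fork_le {M : Type u} {ρ : M → M → ℝ≥0∞} {c r : ℝ≥0∞}
    (hfork : ∀ x y z w, 2 * (ρ x z + ρ x w + c * ρ z w) ≤ r * (ρ y z + ρ y w + 2 * ρ x y))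
    {f : Ω → M} (hf : Measurable fun p : Ω × Ω => ρ (f p.1) (f p.2))
    {τ : ℤ} {V : ℤ → S → Ω} (hW : IsMarkovChain κ P W)
    (hV : IsResampledAfter κ P W τ V) {u t : ℤ} (hu : u ≤ τ) (ht : τ ≤ t) :
    2 * (2 * ∫⁻ ξ, ρ (f (W u ξ)) (f (W t ξ)) ∂P + c * ∫⁻ ξ, ρ (f (W t ξ)) (f (V t ξ)) ∂P) ≤
      r * (2 * ∫⁻ ξ, ρ (f (W τ ξ)) (f (W t ξ)) ∂P +
        2 * ∫⁻ ξ, ρ (f (W u ξ)) (f (W τ ξ)) ∂P) := by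
  obtain ⟨n, rfl⟩ := Int.le.dest ht
  have hm : ∀ {g h : S → Ω}, Measurable g → Measurable h →
      Measurable fun ξ => ρ (f (g ξ)) (f (h ξ)) := fun hg hh => hf.comp (hg.prodMk hh)
  have e1 := hV.lintegral_eq hW hu n _ hf
  have e2 := hV.lintegral_eq hW le_rfl n _ hf
  have mW := hW.measurable
  have mV := hV.measurable
  have key := lintegral_mono (μ := P) fun ξ => hfork (f (W u ξ)) (f (W τ ξ))
    (f (W (τ + n) ξ)) (f (V (τ + n) ξ))
  rw [lintegral_const_mul, lintegral_const_mul, lintegral_add_left, lintegral_add_left,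
    lintegral_const_mul, lintegral_add_left, lintegral_add_left, lintegral_const_mul] at key
  · dsimp only at e1 e2
    rwa [e1, e2, ← two_mul, ← two_mul] at key
  all_goals
    first
    | exact hm (mW _) (mW _)
    | exact hm (mW _) (mV _)
    | exact (hm (mW _) (mW _)).add (hm (mW _) (mV _))
    | exact ((hm (mW _) (mW _)).add (hm (mW _) (mV _))).add ((hm (mW _) (mV _)).const_mul _)
    | exact ((hm (mW _) (mW _)).add (hm (mW _) (mV _))).add ((hm (mW _) (mW _)).const_mul _)

end Markov

/-- Dividing the `s`-th inequality by `r ^ (s + 1)` makes it telescope. The partial sums stay on the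
left with `a N`, so nothing is subtracted and `a` may be infinite. -/
theorem ENNReal.tsum_mul_inv_pow_le_of_telescope {a b : ℕ → ℝ≥0∞} {c r : ℝ≥0∞} (hr : r ≠ 0)
    (hr' : r ≠ ⊤) (h : ∀ s, a (s + 1) + c * b s ≤ r * a s) :
    c * r⁻¹ * ∑' s, b s * r⁻¹ ^ s ≤ a 0 := by
  have key : ∀ N, a N * r⁻¹ ^ N + c * r⁻¹ * ∑ s ∈ Finset.range N, b s * r⁻¹ ^ s ≤ a 0 := by
    intro N
    induction N with
    | zero => simp
    | succ N ih =>
      refine le_trans ?_ ih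
      rw [Finset.sum_range_succ, mul_add, ← add_assoc, add_right_comm]
      gcongr
      calc a (N + 1) * r⁻¹ ^ (N + 1) + c * r⁻¹ * (b N * r⁻¹ ^ N)
          = (a (N + 1) + c * b N) * r⁻¹ ^ (N + 1) := by ring
        _ ≤ r * a N * r⁻¹ ^ (N + 1) := by gcongr; exact h N
        _ = (r * r⁻¹) * (a N * r⁻¹ ^ N) := by ring
        _ = a N * r⁻¹ ^ N := by rw [ENNReal.mul_inv_cancel hr hr', one_mul]
  rw [← ENNReal.tsum_mul_left]
  refine ENNReal.tsum_le_of_sum_range_le fun N => ?_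
  rw [← Finset.mul_sum]
  exact le_add_self.trans (key N)

/-- A metric space is Markov `q`-convex if the `q`-th power of its metric is comparable to a
continuous function which satisfies the fork inequality. -/
theorem isMarkovConvex_of_fork {M : Type u} [MetricSpace M] {q : ℝ} (hq : 0 < q)
    {ρ : M → M → ℝ≥0∞} (hρ : Continuous fun x : M × M => ρ x.1 x.2)
    {c C₁ C₂ : ℝ≥0∞} (hc : c ≠ 0) (hc' : c ≠ ⊤) (hC₁ : C₁ ≠ ⊤) (hC₂ : C₂ ≠ ⊤)
    (h₁ : ∀ x y, edist x y ^ q ≤ C₁ * ρ x y) (h₂ : ∀ x y, ρ x y ≤ C₂ * edist x y ^ q)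
    (hfork : ∀ x y z w,
      2 * (ρ x z + ρ x w + c * ρ z w) ≤ (2 : ℝ≥0∞) ^ q * (ρ y z + ρ y w + 2 * ρ x y)) :
    IsMarkovConvex.{u, v} q M := by
  set r : ℝ≥0∞ := (2 : ℝ≥0∞) ^ q with hr
  have hr0 : r ≠ 0 := by simp [hr]
  have hrt : r ≠ ⊤ := by simp [hr]
  set k : ℝ≥0∞ := c / 2 * r⁻¹ with hk
  have hk0 : k ≠ 0 := mul_ne_zero (by simp [hc]) (by simpa using hrt)
  have hkt : k ≠ ⊤ := ENNReal.mul_ne_top (by finiteness) (by simpa using hr0)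
  set K : ℝ≥0∞ := C₁ * k⁻¹ * C₂ with hK
  have hKt : K ≠ ⊤ := ENNReal.mul_ne_top (ENNReal.mul_ne_top hC₁ (by simpa using hk0)) hC₂
  -- The summand `1` makes the constant positive even if `K = 0`.
  refine ⟨(K.toReal + 1) ^ (1 / q), by positivity, ?_⟩
  intro Ω S _ _ P _ κ _ W V f hW hV hf
  have hfm : Measurable fun p : Ω × Ω => ρ (f p.1) (f p.2) :=
    (hρ.comp_stronglyMeasurable
      ((hf.comp_measurable measurable_fst).prodMk (hf.comp_measurable measurable_snd))).measurable
  let A : ℕ → ℝ≥0∞ := fun s => ∑' t : ℤ, ∫⁻ ξ, ρ (f (W (t - 2 ^ s) ξ)) (f (W t ξ)) ∂P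
  let B : ℕ → ℝ≥0∞ := fun s => ∑' t : ℤ, ∫⁻ ξ, ρ (f (W t ξ)) (f (V (t - 2 ^ s) t ξ)) ∂P
  have hstep : ∀ s, A (s + 1) + c / 2 * B s ≤ r * A s := by
    intro s
    have h2 : (0 : ℤ) < 2 ^ s := by positivity
    have key : 2 * (2 * A (s + 1) + c * B s) ≤ r * (2 * A s + 2 * A s) := by
      have hshift : A s = ∑' t : ℤ,
          ∫⁻ ξ, ρ (f (W (t - 2 ^ (s + 1)) ξ)) (f (W (t - 2 ^ s) ξ)) ∂P := by
        refine ((Equiv.subRight ((2 : ℤ) ^ s)).tsum_eq fun t : ℤ =>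
          ∫⁻ ξ, ρ (f (W (t - 2 ^ s) ξ)) (f (W t ξ)) ∂P).symm.trans (tsum_congr fun t => ?_)
        have e : t - 2 ^ s - 2 ^ s = t - 2 ^ (s + 1) := by ring
        simp only [Equiv.subRight_apply, e]
      -- One copy of `A s` is kept and the other is shifted by `2 ^ s`, so that for each `t` they
      -- supply the prong and the stem of the same fork.
      conv_rhs => rw [hshift]
      conv_rhs => enter [2, 1]; rw [← hshift]
      simp only [A, B]
      simp only [← ENNReal.tsum_mul_left, ← ENNReal.tsum_add]
      refine ENNReal.tsum_le_tsum fun t => ?_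
      refine (hV (t - 2 ^ s)).lintegral_fork_le hfork hfm hW ?_ ?_
      · rw [pow_succ]; linarith
      · linarith
    have h4 : (4 : ℝ≥0∞) ≠ 0 := by norm_num
    rw [← ENNReal.mul_le_mul_iff_right h4 (by norm_num)]
    calc 4 * (A (s + 1) + c / 2 * B s) = 2 * (2 * A (s + 1) + 2 * (c / 2) * B s) := by ring
      _ = 2 * (2 * A (s + 1) + c * B s) := by
        rw [ENNReal.mul_div_cancel (by norm_num) (by norm_num)]
      _ ≤ r * (2 * A s + 2 * A s) := key
      _ = 4 * (r * A s) := by ring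
  have htel := ENNReal.tsum_mul_inv_pow_le_of_telescope hr0 hrt hstep
  rw [← hk] at htel
  have hB : ∑' s, B s * r⁻¹ ^ s ≤ k⁻¹ * A 0 := by
    rw [← ENNReal.mul_le_mul_iff_right hk0 hkt, ← mul_assoc k, ENNReal.mul_inv_cancel hk0 hkt,
      one_mul]
    exact htel
  have hA : A 0 ≤ C₂ * ∑' t : ℤ, ∫⁻ ξ, edist (f (W t ξ)) (f (W (t - 1) ξ)) ^ q ∂P := by
    simp only [A, pow_zero, ← ENNReal.tsum_mul_left]
    refine ENNReal.tsum_le_tsum fun t => ?_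
    rw [← lintegral_const_mul' _ _ hC₂]
    refine lintegral_mono fun ξ => ?_
    rw [edist_comm]
    exact h₂ _ _
  have hLHS : ∑' (s : ℕ) (t : ℤ),
      (∫⁻ ξ, edist (f (W t ξ)) (f (V (t - 2 ^ s) t ξ)) ^ q ∂P) / (2 : ℝ≥0∞) ^ ((s : ℝ) * q) ≤
        C₁ * ∑' s, B s * r⁻¹ ^ s := by
    rw [← ENNReal.tsum_mul_left]
    refine ENNReal.tsum_le_tsum fun s => ?_
    have e : (2 : ℝ≥0∞) ^ ((s : ℝ) * q) = r ^ s := by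
      rw [mul_comm, ENNReal.rpow_mul, ENNReal.rpow_natCast]
    simp only [e, div_eq_mul_inv, ENNReal.tsum_mul_right]
    rw [← ENNReal.inv_pow, ← mul_assoc]
    gcongr
    simp only [B, ← ENNReal.tsum_mul_left]
    refine ENNReal.tsum_le_tsum fun t => ?_
    rw [← lintegral_const_mul' _ _ hC₁]
    exact lintegral_mono fun ξ => h₁ _ _
  refine hLHS.trans ?_
  calc C₁ * ∑' s, B s * r⁻¹ ^ s
      ≤ C₁ * (k⁻¹ * (C₂ * ∑' t : ℤ, ∫⁻ ξ, edist (f (W t ξ)) (f (W (t - 1) ξ)) ^ q ∂P)) := by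
        gcongr
        exact hB.trans (by gcongr)
    _ = K * ∑' t : ℤ, ∫⁻ ξ, edist (f (W t ξ)) (f (W (t - 1) ξ)) ^ q ∂P := by rw [hK]; ring
    _ ≤ _ := by
        gcongr
        rw [← Real.rpow_mul (by positivity), one_div_mul_cancel hq.ne', Real.rpow_one]
        exact ENNReal.le_ofReal_iff_toReal_le hKt (by positivity) |>.2 (by linarith)

/-! ### The fork inequality in the Heisenberg group -/

section Fork

theorem two_mul_norm_add_rpow_le {E : Type*} [SeminormedAddCommGroup E] {p : ℝ} (hp : 1 ≤ p)
    (x y : E) : 2 * ‖x + y‖ ^ p ≤ 2 ^ p * (‖x‖ ^ p + ‖y‖ ^ p) := by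
  have h1 : ‖x + y‖ ^ p ≤ (‖x‖ + ‖y‖) ^ p :=
    Real.rpow_le_rpow (norm_nonneg _) (norm_add_le x y) (by linarith)
  have h2 : ((‖x‖ + ‖y‖) : ℝ) ^ p ≤ 2 ^ (p - 1) * (‖x‖ ^ p + ‖y‖ ^ p) := by
    have := NNReal.coe_le_coe.2 (NNReal.rpow_add_le_mul_rpow_add_rpow ‖x‖₊ ‖y‖₊ hp)
    push_cast at this
    exact this
  have h3 : (2 : ℝ) * 2 ^ (p - 1) = 2 ^ p := by
    rw [Real.rpow_sub_one two_ne_zero]; ring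
  rw [← h3]
  linarith

theorem norm_add_rpow_le {E : Type*} [SeminormedAddCommGroup E] {p : ℝ} (hp : 1 ≤ p)
    (x y : E) : ‖x + y‖ ^ p ≤ 2 ^ p * (‖x‖ ^ p + ‖y‖ ^ p) := by
  have := two_mul_norm_add_rpow_le hp x y
  have h0 : 0 ≤ ‖x + y‖ ^ p := by positivity
  linarith

theorem norm_sub_rpow_le {E : Type*} [SeminormedAddCommGroup E] {p : ℝ} (hp : 1 ≤ p)
    (x y : E) : ‖x - y‖ ^ p ≤ 2 ^ p * (‖x‖ ^ p + ‖y‖ ^ p) := by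
  have := norm_add_rpow_le hp x (-y)
  rwa [norm_neg, ← sub_eq_add_neg] at this

variable {X : Type u} [NormedAddCommGroup X] [NormedSpace ℝ X] {ω : X →L[ℝ] X →L[ℝ] ℝ}

theorem norm_bilin_rpow_le {p : ℝ} (hp : 1 ≤ p) (x y : X) :
    ‖ω x y‖ ^ p ≤ ‖ω‖ ^ p * (‖x‖ ^ p * ‖y‖ ^ p) := by
  have h0 : 0 ≤ ‖ω‖ := ω.opNorm_nonneg
  rw [← Real.mul_rpow (norm_nonneg _) (norm_nonneg _), ← Real.mul_rpow h0 (by positivity),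
    ← mul_assoc]
  exact Real.rpow_le_rpow (norm_nonneg _) (ω.le_opNorm₂ x y) (by linarith)

theorem two_rpow_mul_norm_bilin_rpow_le {p : ℝ} (hp : 1 ≤ p) (hanti : ∀ x y, ω x y = -ω y x)
    (x y : X) :
    2 ^ p * ‖ω x y‖ ^ p ≤ ‖ω‖ ^ p * (‖x + y‖ ^ p * ‖x - y‖ ^ p) := by
  have e : 2 * ω x y = ω (x + y) (y - x) := by
    have h1 : ω x x = 0 := by linarith [hanti x x]
    have h2 : ω y y = 0 := by linarith [hanti y y]
    simp only [map_add, add_apply, map_sub, h1, h2, hanti y x]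
    ring
  have h := norm_bilin_rpow_le (ω := ω) hp (x + y) (y - x)
  rw [← e, norm_mul, Real.norm_two, Real.mul_rpow zero_le_two (norm_nonneg _),
    norm_sub_rev] at h
  exact h

/-- The `2p`-th power of a homogeneous quasi-norm on the Heisenberg group. -/
noncomputable def quasiNormPow (p lam : ℝ) (g : HeisenbergGroup ω) : ℝ :=
  (‖g.base‖ ^ p) ^ 2 + lam * ‖g.height‖ ^ p

/-- Uniform convexity at `u + v` and `u - v` gives `2 (s + κ d) ≤ 2 ^ p (‖u‖ ^ p + ‖v‖ ^ p)`, where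
`s = ‖u + v‖ ^ p` and `d = ‖u - v‖ ^ p`. Squaring produces `4 κ s d`; half of it pays for `ω u v` in
the height and half remains as a gain. The gain in `h.height` is possible because the convexity
bound for heights only uses half of the factor `(2 ^ p) ^ 2`. -/
theorem quasiNormPow_mul_le {p κ lam : ℝ} (hp : 1 ≤ p) (hanti : ∀ x y, ω x y = -ω y x)
    (hκ : 0 ≤ κ)
    (hX : ∀ x y : X, ‖x‖ ^ p + κ * ‖y‖ ^ p ≤ (‖x + y‖ ^ p + ‖x - y‖ ^ p) / 2)
    (hlam : 0 ≤ lam) (hlamκ : lam * ‖ω‖ ^ p ≤ 2 * κ) (g h : HeisenbergGroup ω) :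
    2 * quasiNormPow p lam (g * h) + (2 * κ ^ 2 * (‖g.base - h.base‖ ^ p) ^ 2
      + 2 * κ * (‖g.base + h.base‖ ^ p * ‖g.base - h.base‖ ^ p)
      + lam * (2 ^ p) ^ 2 / 2 * ‖h.height‖ ^ p) ≤
      (2 ^ p) ^ 2 * (quasiNormPow p lam g + quasiNormPow p lam h) := by
  obtain ⟨u, a⟩ := g
  obtain ⟨v, b⟩ := h
  simp only [quasiNormPow, HeisenbergGroup.base_mul, HeisenbergGroup.height_mul]
  have hconv := hX (u + v) (u - v)
  rw [show u + v + (u - v) = (2 : ℝ) • u by rw [two_smul]; abel,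
    show u + v - (u - v) = (2 : ℝ) • v by rw [two_smul]; abel, norm_smul, norm_smul,
    Real.norm_two, Real.mul_rpow zero_le_two (norm_nonneg _),
    Real.mul_rpow zero_le_two (norm_nonneg _)] at hconv
  have hω := two_rpow_mul_norm_bilin_rpow_le hp hanti u v
  have h1 := two_mul_norm_add_rpow_le hp (a + b) (ω u v)
  have h2 := two_mul_norm_add_rpow_le hp a b
  have hs : 0 ≤ ‖u + v‖ ^ p := by positivity
  have hd : 0 ≤ ‖u - v‖ ^ p := by positivity
  have hu : 0 ≤ ‖u‖ ^ p := by positivity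
  have hv : 0 ≤ ‖v‖ ^ p := by positivity
  have ha : 0 ≤ ‖a‖ ^ p := by positivity
  have hb : 0 ≤ ‖b‖ ^ p := by positivity
  have hT : (0 : ℝ) < 2 ^ p := by positivity
  generalize ‖u + v‖ ^ p = s at *
  generalize ‖u - v‖ ^ p = d at *
  generalize ‖u‖ ^ p = U at *
  generalize ‖v‖ ^ p = V at *
  generalize ‖a‖ ^ p = A at *
  generalize ‖b‖ ^ p = B at *
  generalize ‖a + b + ω u v‖ ^ p = Z at *
  generalize ‖a + b‖ ^ p = Y at *
  generalize ‖ω u v‖ ^ p = Q at *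
  generalize ‖ω‖ ^ p = β at *
  generalize (2 : ℝ) ^ p = T at *
  have hhor : 2 * (s + κ * d) ^ 2 ≤ T ^ 2 * (U ^ 2 + V ^ 2) := by
    have h3 : (2 * (s + κ * d)) ^ 2 ≤ (T * (U + V)) ^ 2 :=
      pow_le_pow_left₀ (by positivity) (by linarith) 2
    have h4 : 0 ≤ T ^ 2 * (U - V) ^ 2 := by positivity
    linarith
  have hver : 2 * Z ≤ T ^ 2 / 2 * (A + B) + β * (s * d) := by
    have := mul_le_mul_of_nonneg_left h2 hT.le
    linarith
  have hver' := mul_le_mul_of_nonneg_left hver hlam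
  have hsd := mul_le_mul_of_nonneg_right hlamκ (mul_nonneg hs hd)
  have hA : 0 ≤ lam * T ^ 2 / 2 * A := by positivity
  linarith

/-- The gains of `quasiNormPow_mul_le` for two prongs `g`, `h` with common stem base `u` control the
quasi-norm between the tips. -/
theorem quasiNormPow_inv_mul_le {p lam : ℝ} (hp : 1 ≤ p) (hanti : ∀ x y, ω x y = -ω y x)
    (hlam : 0 ≤ lam) : ∃ M : ℝ, 0 < M ∧ ∀ (u : X) (g h : HeisenbergGroup ω),
      quasiNormPow p lam (g⁻¹ * h) ≤ M * (
        ((‖u - g.base‖ ^ p) ^ 2 + ‖u + g.base‖ ^ p * ‖u - g.base‖ ^ p + ‖g.height‖ ^ p) +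
        ((‖u - h.base‖ ^ p) ^ 2 + ‖u + h.base‖ ^ p * ‖u - h.base‖ ^ p + ‖h.height‖ ^ p)) := by
  have hself : ∀ x, ω x x = 0 := fun x => by linarith [hanti x x]
  have hω0 : 0 ≤ ‖ω‖ := ω.opNorm_nonneg
  have hT0 : (0 : ℝ) < 2 ^ p := by positivity
  have hβ0 : 0 ≤ ‖ω‖ ^ p := by positivity
  refine ⟨2 * (2 ^ p) ^ 2 + lam * (2 ^ p) ^ 2 * (1 + ‖ω‖ ^ p), by positivity, fun u g h => ?_⟩
  obtain ⟨v, b⟩ := g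
  obtain ⟨w, c⟩ := h
  simp only [quasiNormPow, HeisenbergGroup.base_mul, HeisenbergGroup.height_mul,
    HeisenbergGroup.base_inv, HeisenbergGroup.height_inv, hself, map_neg, neg_apply]
  -- Everything is re-centred at `u`: `ω u v` and `ω u w` are bounded by the products of sums and
  -- differences, and the remaining term `ω (u - v) (u - w)` by the differences alone.
  rw [show -v + w = (u - v) - (u - w) by abel,
    show 0 - b + c + -ω v w = (c - b) - ((ω u w - ω u v) + ω (u - v) (u - w)) by
      simp only [map_sub, sub_apply, hself, hanti v u]; ring]
  have h1 := norm_sub_rpow_le hp (u - v) (u - w)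
  have h2 := norm_sub_rpow_le hp (c - b) ((ω u w - ω u v) + ω (u - v) (u - w))
  have h3 := norm_sub_rpow_le hp c b
  have h4 := norm_add_rpow_le hp (ω u w - ω u v) (ω (u - v) (u - w))
  have h5 := norm_sub_rpow_le hp (ω u w) (ω u v)
  have h6 := two_rpow_mul_norm_bilin_rpow_le hp hanti u v
  have h7 := two_rpow_mul_norm_bilin_rpow_le hp hanti u w
  have h8 := norm_bilin_rpow_le (ω := ω) hp (u - v) (u - w)
  have k1 : 0 ≤ ‖u + v‖ ^ p := by positivity
  have k2 : 0 ≤ ‖u - v‖ ^ p := by positivity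
  have k3 : 0 ≤ ‖u + w‖ ^ p := by positivity
  have k4 : 0 ≤ ‖u - w‖ ^ p := by positivity
  have k5 : 0 ≤ ‖b‖ ^ p := by positivity
  have k6 : 0 ≤ ‖c‖ ^ p := by positivity
  have k7 : 0 ≤ ‖u - v - (u - w)‖ ^ p := by positivity
  generalize ‖u - v - (u - w)‖ ^ p = D at *
  generalize ‖c - b - ((ω u w - ω u v) + ω (u - v) (u - w))‖ ^ p = Z at *
  generalize ‖(ω u w - ω u v) + ω (u - v) (u - w)‖ ^ p = Z₁ at *
  generalize ‖ω u w - ω u v‖ ^ p = Z₂ at *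
  generalize ‖c - b‖ ^ p = Z₃ at *
  generalize ‖ω u w‖ ^ p = Z₄ at *
  generalize ‖ω u v‖ ^ p = Z₅ at *
  generalize ‖ω (u - v) (u - w)‖ ^ p = Z₆ at *
  generalize ‖u + v‖ ^ p = s₁ at *
  generalize ‖u - v‖ ^ p = d₁ at *
  generalize ‖u + w‖ ^ p = s₂ at *
  generalize ‖u - w‖ ^ p = d₂ at *
  generalize ‖b‖ ^ p = B at *
  generalize ‖c‖ ^ p = C at *
  generalize ‖ω‖ ^ p = β at *
  generalize (2 : ℝ) ^ p = T at *
  have hD : D ^ 2 ≤ 2 * T ^ 2 * (d₁ ^ 2 + d₂ ^ 2) := by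
    have e1 := pow_le_pow_left₀ k7 h1 2
    have e2 : 0 ≤ T ^ 2 * (d₁ - d₂) ^ 2 := by positivity
    linarith
  have hdd : d₁ * d₂ ≤ d₁ ^ 2 + d₂ ^ 2 := by nlinarith [sq_nonneg (d₁ - d₂), mul_nonneg k2 k4]
  have hZ : Z ≤ T ^ 2 * (B + C + β * (s₁ * d₁ + s₂ * d₂) + β * (d₁ ^ 2 + d₂ ^ 2)) := by
    have hZ₁ : Z₁ ≤ T * (β * (s₁ * d₁ + s₂ * d₂) + β * (d₁ ^ 2 + d₂ ^ 2)) := by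
      refine h4.trans (mul_le_mul_of_nonneg_left ?_ hT0.le)
      have := mul_le_mul_of_nonneg_left hdd hβ0
      linarith
    have := mul_le_mul_of_nonneg_left (add_le_add h3 hZ₁) hT0.le
    linarith
  have hZ' := mul_le_mul_of_nonneg_left hZ hlam
  have r1 : 0 ≤ s₁ * d₁ + s₂ * d₂ := by positivity
  have r2 : 0 ≤ 2 * T ^ 2 * (s₁ * d₁ + s₂ * d₂ + B + C) := by positivity
  have r3 : 0 ≤ lam * T ^ 2 * (s₁ * d₁ + s₂ * d₂ + (d₁ ^ 2 + d₂ ^ 2)) := by positivity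
  have r4 : 0 ≤ lam * T ^ 2 * (β * (B + C)) := by positivity
  linarith

theorem exists_quasiNormPow_fork {p : ℝ} (hp : 1 ≤ p) (hanti : ∀ x y, ω x y = -ω y x)
    (hX : IsPUniformlyConvex p X) :
    ∃ lam c : ℝ, 0 < lam ∧ 0 < c ∧ ∀ x y z w : HeisenbergGroup ω,
      2 * (quasiNormPow p lam (x⁻¹ * z) + quasiNormPow p lam (x⁻¹ * w)
        + c * quasiNormPow p lam (z⁻¹ * w)) ≤
      (2 ^ p) ^ 2 * (quasiNormPow p lam (y⁻¹ * z) + quasiNormPow p lam (y⁻¹ * w)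
        + 2 * quasiNormPow p lam (x⁻¹ * y)) := by
  obtain ⟨K, hK, hconv⟩ := hX
  have hω0 : 0 ≤ ‖ω‖ := ω.opNorm_nonneg
  have hβ0 : 0 ≤ ‖ω‖ ^ p := by positivity
  obtain ⟨κ, hκ⟩ : ∃ κ, κ = 1 / K ^ p := ⟨_, rfl⟩
  rw [← hκ] at hconv
  have hκ0 : 0 < κ := by rw [hκ]; positivity
  -- Small enough that the height error fits into half of the cross term `4 κ s d`.
  set lam := κ / (‖ω‖ ^ p + 1) with hlam
  have hlam0 : 0 < lam := by positivity
  have hlamκ : lam * ‖ω‖ ^ p ≤ 2 * κ := by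
    rw [hlam, div_mul_eq_mul_div, div_le_iff₀ (by positivity)]
    nlinarith
  obtain ⟨M, hM, htip⟩ := quasiNormPow_inv_mul_le hp hanti hlam0.le
  set m := min (2 * κ ^ 2) (min (2 * κ) (lam * (2 ^ p) ^ 2 / 2)) with hm
  have hm0 : 0 < m := by positivity
  have hm1 : m ≤ 2 * κ ^ 2 := min_le_left _ _
  have hm2 : m ≤ 2 * κ := (min_le_right _ _).trans (min_le_left _ _)
  have hm3 : m ≤ lam * (2 ^ p) ^ 2 / 2 := (min_le_right _ _).trans (min_le_right _ _)
  -- The two gains have weight `m` and dominate `1 / M` times the tip term, which enters the fork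
  -- inequality with factor `2 * c`.
  refine ⟨lam, m / (2 * M), hlam0, by positivity, fun x y z w => ?_⟩
  have half : ∀ g h : HeisenbergGroup ω, 2 * quasiNormPow p lam (g * h) +
      m * ((‖g.base - h.base‖ ^ p) ^ 2 + ‖g.base + h.base‖ ^ p * ‖g.base - h.base‖ ^ p
        + ‖h.height‖ ^ p) ≤
      (2 ^ p) ^ 2 * (quasiNormPow p lam g + quasiNormPow p lam h) := fun g h => by
    refine le_trans ?_ (quasiNormPow_mul_le hp hanti hκ0.le hconv hlam0.le hlamκ g h)
    rw [mul_add m, mul_add m]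
    gcongr
  have h1 := half (x⁻¹ * y) (y⁻¹ * z)
  have h2 := half (x⁻¹ * y) (y⁻¹ * w)
  have h3 := htip (x⁻¹ * y).base (y⁻¹ * z) (y⁻¹ * w)
  rw [show x⁻¹ * y * (y⁻¹ * z) = x⁻¹ * z by group] at h1
  rw [show x⁻¹ * y * (y⁻¹ * w) = x⁻¹ * w by group] at h2
  rw [show (y⁻¹ * z)⁻¹ * (y⁻¹ * w) = z⁻¹ * w by group] at h3
  have h4 := mul_le_mul_of_nonneg_left h3 (show 0 ≤ m / M by positivity)
  rw [← mul_assoc, div_mul_cancel₀ m hM.ne'] at h4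
  have e : 2 * (m / (2 * M) * quasiNormPow p lam (z⁻¹ * w)) =
      m / M * quasiNormPow p lam (z⁻¹ * w) := by field_simp
  linarith

end Fork

/-! ### Comparison of the quasi-norm and the metric -/

section Comparison

variable {X : Type u} [NormedAddCommGroup X] [NormedSpace ℝ X] {ω : X →L[ℝ] X →L[ℝ] ℝ}

theorem quasiNormPow_nonneg {p lam : ℝ} (hlam : 0 ≤ lam) (g : HeisenbergGroup ω) :
    0 ≤ quasiNormPow p lam g := by
  unfold quasiNormPow
  positivity

theorem sqrt_rpow_two_mul {x : ℝ} (hx : 0 ≤ x) (p : ℝ) : √x ^ (2 * p) = x ^ p := by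
  rw [Real.rpow_mul (Real.sqrt_nonneg _), Real.rpow_two, Real.sq_sqrt hx]

theorem rpow_sq_eq_rpow_two_mul {x : ℝ} (hx : 0 ≤ x) (p : ℝ) : (x ^ p) ^ 2 = x ^ (2 * p) := by
  rw [mul_comm, Real.rpow_mul hx, Real.rpow_two]

theorem exists_ccDist_rpow_le {p lam : ℝ} (hp : 1 ≤ p) (hlam : 0 < lam)
    (hanti : ∀ x y, ω x y = -ω y x) (hω : ω ≠ 0) :
    ∃ C : ℝ≥0∞, C ≠ ⊤ ∧ ∀ a b : HeisenbergGroup ω,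
      ccDist ω a b ^ (2 * p) ≤ C * ENNReal.ofReal (quasiNormPow p lam (a⁻¹ * b)) := by
  obtain ⟨C, hC0, hC⟩ := exists_ccDist_le hanti hω
  set D : ℝ := 2 ^ (2 * p) * (1 + C ^ (2 * p) / lam) with hD
  refine ⟨ENNReal.ofReal D, ENNReal.ofReal_ne_top, fun a b => ?_⟩
  have h1 := ENNReal.rpow_le_rpow (hC a b) (show 0 ≤ 2 * p by linarith)
  rw [ENNReal.ofReal_rpow_of_nonneg (by positivity) (by linarith)] at h1
  rw [← ENNReal.ofReal_mul (by positivity)]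
  refine h1.trans (ENNReal.ofReal_le_ofReal ?_)
  generalize a⁻¹ * b = g
  have h2 := norm_add_rpow_le (p := 2 * p) (by linarith) ‖g.base‖ (C * √|g.height|)
  have hr : 0 ≤ C * √|g.height| := by positivity
  rw [norm_norm, Real.norm_of_nonneg hr, Real.norm_of_nonneg (by positivity),
    Real.mul_rpow hC0 (Real.sqrt_nonneg _), sqrt_rpow_two_mul (abs_nonneg _),
    ← rpow_sq_eq_rpow_two_mul (norm_nonneg _)] at h2
  refine h2.trans ?_
  rw [hD, mul_assoc, quasiNormPow, Real.norm_eq_abs]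
  gcongr
  have e : (1 + C ^ (2 * p) / lam) * ((‖g.base‖ ^ p) ^ 2 + lam * |g.height| ^ p) =
      (‖g.base‖ ^ p) ^ 2 + C ^ (2 * p) * |g.height| ^ p + lam * |g.height| ^ p +
        C ^ (2 * p) / lam * (‖g.base‖ ^ p) ^ 2 := by
    field_simp
    ring
  rw [e, add_assoc _ (lam * _)]
  exact le_add_of_nonneg_right (by positivity)

theorem exists_quasiNormPow_le {p lam : ℝ} (hp : 1 ≤ p) (hlam : 0 ≤ lam) (hω : ω ≠ 0) :
    ∃ C : ℝ≥0∞, C ≠ ⊤ ∧ ∀ a b : HeisenbergGroup ω,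
      ENNReal.ofReal (quasiNormPow p lam (a⁻¹ * b)) ≤ C * ccDist ω a b ^ (2 * p) := by
  have hp0 : 0 ≤ 2 * p := by linarith
  refine ⟨1 + ENNReal.ofReal lam * ENNReal.ofReal √‖ω‖ ^ (2 * p), ?_, fun a b => ?_⟩
  · have := ENNReal.rpow_ne_top_of_nonneg hp0 (ENNReal.ofReal_ne_top (r := √‖ω‖))
    finiteness
  have h1 := ENNReal.rpow_le_rpow (enorm_base_le_ccDist a b) hp0
  have h2 := ENNReal.rpow_le_rpow (ofReal_sqrt_height_le_ccDist hω a b) hp0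
  rw [ENNReal.mul_rpow_of_nonneg _ _ hp0,
    ENNReal.ofReal_rpow_of_nonneg (Real.sqrt_nonneg _) hp0, sqrt_rpow_two_mul (abs_nonneg _)] at h2
  rw [← ofReal_norm, ENNReal.ofReal_rpow_of_nonneg (norm_nonneg _) hp0,
    ← rpow_sq_eq_rpow_two_mul (norm_nonneg _)] at h1
  rw [quasiNormPow, ENNReal.ofReal_add (by positivity) (by positivity),
    ENNReal.ofReal_mul hlam, add_mul, one_mul, mul_assoc, Real.norm_eq_abs]
  gcongr

/-- Needed to make `ρ` measurable along a strongly measurable `f`. The topology is that of the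
metric, so continuity of both coordinates has to be derived from the lower bounds on the distance.
-/
theorem continuous_quasiNormPow_inv_mul {p lam : ℝ} (hp : 1 ≤ p)
    (hanti : ∀ x y, ω x y = -ω y x) (hω : ω ≠ 0) :
    letI := ccMetricSpace hanti hω
    Continuous fun x : HeisenbergGroup ω × HeisenbergGroup ω =>
      quasiNormPow p lam (x.1⁻¹ * x.2) := by
  let _ := ccMetricSpace hanti hω
  have hself : ∀ x, ω x x = 0 := fun x => by linarith [hanti x x]
  have hb : Continuous (HeisenbergGroup.base : HeisenbergGroup ω → X) := by
    refine (LipschitzWith.of_edist_le fun a b => ?_ : LipschitzWith 1 _).continuous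
    refine le_trans (le_of_eq ?_) (enorm_base_le_ccDist a b)
    rw [edist_comm, edist_eq_enorm_sub, HeisenbergGroup.base_mul, HeisenbergGroup.base_inv,
      neg_add_eq_sub]
  have hh : Continuous (HeisenbergGroup.height : HeisenbergGroup ω → ℝ) := by
    refine continuous_iff_continuousAt.2 fun a => ?_
    have h1 : ∀ b : HeisenbergGroup ω, √|(a⁻¹ * b).height| ≤ √‖ω‖ * dist a b := fun b => by
      have h := ofReal_sqrt_height_le_ccDist hω a b
      rw [← edist_ccMetricSpace hanti hω a b, edist_dist,
        ← ENNReal.ofReal_mul (Real.sqrt_nonneg _)] at h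
      exact (ENNReal.ofReal_le_ofReal_iff (by positivity)).1 h
    have h2 : Filter.Tendsto (fun b : HeisenbergGroup ω => √|(a⁻¹ * b).height|) (nhds a)
        (nhds 0) := by
      refine squeeze_zero (fun _ => Real.sqrt_nonneg _) h1 ?_
      have : Filter.Tendsto (fun b : HeisenbergGroup ω => √‖ω‖ * dist a b) (nhds a)
          (nhds (√‖ω‖ * dist a a)) := by
        exact ((continuous_const.dist continuous_id).tendsto a).const_mul _
      simpa using this
    have h3 : Filter.Tendsto (fun b : HeisenbergGroup ω => (a⁻¹ * b).height) (nhds a)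
        (nhds 0) := by
      rw [tendsto_zero_iff_abs_tendsto_zero]
      have := h2.pow 2
      simpa [Function.comp_def, Real.sq_sqrt] using this
    -- The height of `b` is that of `a⁻¹ * b`, which tends to `0`, plus this correction, continuous
    -- in the base.
    have h4 : Filter.Tendsto (fun b : HeisenbergGroup ω => a.height + ω a.base b.base) (nhds a)
        (nhds (a.height + ω a.base a.base)) :=
      (((ω a.base).continuous.comp hb).tendsto a).const_add _
    have h5 := h3.add h4
    rw [hself, add_zero, zero_add] at h5
    refine h5.congr fun b => ?_
    simp only [HeisenbergGroup.height_mul, HeisenbergGroup.height_inv, HeisenbergGroup.base_inv,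
      hself, map_neg, neg_apply]
    ring
  have hp0 : 0 ≤ p := by linarith
  simp only [quasiNormPow, HeisenbergGroup.base_mul, HeisenbergGroup.height_mul,
    HeisenbergGroup.base_inv, HeisenbergGroup.height_inv, hself, zero_sub]
  have hb1 : Continuous fun x : HeisenbergGroup ω × HeisenbergGroup ω => -x.1.base :=
    (hb.comp continuous_fst).neg
  have hb2 : Continuous fun x : HeisenbergGroup ω × HeisenbergGroup ω => x.2.base :=
    hb.comp continuous_snd
  have hω2 : Continuous fun x : HeisenbergGroup ω × HeisenbergGroup ω =>
      ω (-x.1.base) x.2.base := (ω.continuous.comp hb1).clm_apply hb2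
  exact (((hb1.add hb2).norm.rpow_const fun _ => Or.inr hp0).pow 2).add
    (continuous_const.mul
      (((((hh.comp continuous_fst).neg.add (hh.comp continuous_snd)).add hω2).norm).rpow_const
        fun _ => Or.inr hp0))

end Comparison

/-! ### The main theorem: transfer of the real fork inequality to `ℝ≥0∞` -/

theorem mainTheorem8 {X : Type u} [NormedAddCommGroup X] [NormedSpace ℝ X] [CompleteSpace X]
    (p : ℝ) (hp : 2 ≤ p) (hX : IsPUniformlyConvex p X)
    (ω : X →L[ℝ] X →L[ℝ] ℝ) (hanti : ∀ x y : X, ω x y = -ω y x) (hω : ω ≠ 0) :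
    ∃ m : MetricSpace (HeisenbergGroup ω),
      (∀ a b : HeisenbergGroup ω, edist a b = ccDist ω a b) ∧
      IsMarkovConvex.{u, v} (2 * p) (HeisenbergGroup ω) := by
  have hp1 : 1 ≤ p := by linarith
  let _ := ccMetricSpace hanti hω
  refine ⟨ccMetricSpace hanti hω, fun _ _ => rfl, ?_⟩
  obtain ⟨lam, c, hlam, hc, hfork⟩ := exists_quasiNormPow_fork hp1 hanti hX
  obtain ⟨C₁, hC₁, h₁⟩ := exists_ccDist_rpow_le hp1 hlam hanti hω
  obtain ⟨C₂, hC₂, h₂⟩ := exists_quasiNormPow_le hp1 hlam.le hω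
  refine isMarkovConvex_of_fork (by linarith)
    (ρ := fun a b => ENNReal.ofReal (quasiNormPow p lam (a⁻¹ * b)))
    (ENNReal.continuous_ofReal.comp (continuous_quasiNormPow_inv_mul hp1 hanti hω))
    (c := ENNReal.ofReal c) (by simpa using hc) ENNReal.ofReal_ne_top hC₁ hC₂ h₁ h₂ ?_
  intro x y z w
  have hN : ∀ g : HeisenbergGroup ω, 0 ≤ quasiNormPow p lam g := quasiNormPow_nonneg hlam.le
  have e2 : (2 : ℝ≥0∞) = ENNReal.ofReal 2 := by simp
  have eT : (2 : ℝ≥0∞) ^ (2 * p) = ENNReal.ofReal ((2 ^ p) ^ 2) := by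
    rw [rpow_sq_eq_rpow_two_mul zero_le_two, ← ENNReal.ofReal_rpow_of_pos two_pos, ← e2]
  rw [eT, e2, ← ENNReal.ofReal_mul hc.le, ← ENNReal.ofReal_mul zero_le_two,
    ← ENNReal.ofReal_add (hN _) (hN _), ← ENNReal.ofReal_add (hN _) (hN _),
    ← ENNReal.ofReal_add (add_nonneg (hN _) (hN _)) (mul_nonneg hc.le (hN _)),
    ← ENNReal.ofReal_add (add_nonneg (hN _) (hN _)) (mul_nonneg zero_le_two (hN _)),
    ← ENNReal.ofReal_mul zero_le_two, ← ENNReal.ofReal_mul (by positivity)]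
  exact ENNReal.ofReal_le_ofReal (hfork x y z w)
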